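/- Let $n$ be a positive integer, $A_n=\mathbb{C}[t_1,\dots,t_n]$, and let $W_n=\mathrm{Der}(A_n)$ be the Witt algebra, with the commutator bracket. Put $\partial_i=\partial/\partial t_i$, $h_i=t_i\partial_i$, $h^{\mathbf m}=h_1^{m_1}\cdots h_n^{m_n}\in U(W_n)$ for $\mathbf m\in\mathbb{Z}_{\ge 0}^n$, and $\Delta_n=\mathrm{span}\{\partial_1,\dots,\partial_n\}$, an abelian subalgebra of $W_n$. Let $\mathbf a=(a_1,\dots,a_n)\in\mathbb{C}^n$ be non-singular, i.e. $a_i\ne 0$ for all $i$, and let $\phi_{\mathbf a}:\Delta_n\to\mathbb{C}$ be the Lie algebra homomorphism with $\phi_{\mathbf a}(\partial_i)=a_i$. For a $W_n$-module $M$ put $$\mathrm{Wh}_{\mathbf a}(M)=\{v\in M\mid xv=\phi_{\mathbf a}(x)v\ \text{ for all } x\in\Delta_n\}.$$ Let $\Omega_{\mathbf a}^W$ be the full subcategory of $W_n$-modules $M$ such that $\Delta_n$ acts locally finitely on $M$, for every $v\in M$ there is a $k$ with $(x-\phi_{\mathbf a}(x))^kv=0$ for all $x\in\Delta_n$, and $\dim\mathrm{Wh}_{\mathbf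 a}(M)<\infty$. Let $\mathbb{C}_{\mathbf a}=\mathbb{C}1_{\mathbf a}$ be the one-dimensional $U(\Delta_n)$-module on which $\Delta_n$ acts by $\phi_{\mathbf a}$, and put $$Q_{\mathbf a}=U(W_n)\otimes_{U(\Delta_n)}\mathbb{C}_{\mathbf a},\qquad H_{\mathbf a}=\mathrm{End}_{W_n}(Q_{\mathbf a})^{\mathrm{op}},$$ so that $Q_{\mathbf a}$ is a left $U(W_n)$-module and a right $H_{\mathbf a}$-module, and $\mathrm{Wh}_{\mathbf a}(M)\cong\mathrm{Hom}_{W_n}(Q_{\mathbf a},M)$ (a Whittaker vector $v$ corresponds to the homomorphism with $1\otimes 1_{\mathbf a}\mapsto v$) is a left $H_{\mathbf a}$-module through precomposition. Then: (a) $Q_{\mathbf a}$ is a free right $H_{\mathbf a}$-module, with basis $\{h^{\mathbf m}\otimes 1_{\mathbf a}\mid \mathbf m\in\mathbb{Z}_{\ge 0}^n\}$. (b) The functors $M\mapsto\mathrm{Wh}_{\mathbf a}(M)$ and $V\mapsto Q_{\mathbf a}\otimes_{H_{\mathbf a}}V$ restrict to mutually inverse equivalences between $\Omega_{\mathbf a}^W$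 and the category of finite-dimensional left $H_{\mathbf a}$-modules. -/

import Mathlib

open CategoryTheory MulOpposite
open scoped TensorProduct

/-! ### Tensor products over a noncommutative ring -/

section BalancedTensor

set_option linter.unusedSectionVars false

universe u₁ u₂ u₃ u₄

variable (S : Type u₁) (R : Type u₂) (M : Type u₃) (N : Type u₄) [Ring S] [Ring R]
  [AddCommGroup M] [Module S M] [Module Rᵐᵒᵖ M] [SMulCommClass S Rᵐᵒᵖ M]
  [AddCommGroup N] [Module R N]

/-- The relations `(m · r) ⊗ n - m ⊗ (r • n)` in `M ⊗[ℤ] N`, for an `(S, R)`-bimodule `M` and a left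
`R`-module `N`. The subgroup they generate is stable under `S`, so it is also the `S`-submodule
they generate. -/
def balancedRelations : Submodule S (M ⊗[ℤ] N) :=
  Submodule.span S {z | ∃ (m : M) (r : R) (n : N), z = (op r • m) ⊗ₜ[ℤ] n - m ⊗ₜ[ℤ] (r • n)}

/-- The left `S`-module `M ⊗_R N`, for an `(S, R)`-bimodule `M` and a left `R`-module `N` over
arbitrary rings. -/
abbrev BalancedTensor : Type (max u₃ u₄) := (M ⊗[ℤ] N) ⧸ balancedRelations S R M N

variable {M N}

/-- The pure tensor `m ⊗ n` in `M ⊗_R N`. -/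
def BalancedTensor.tmul (m : M) (n : N) : BalancedTensor S R M N :=
  (balancedRelations S R M N).mkQ (m ⊗ₜ[ℤ] n)

theorem BalancedTensor.op_smul_tmul (m : M) (r : R) (n : N) :
    BalancedTensor.tmul S R (op r • m) n = BalancedTensor.tmul S R m (r • n) := by
  unfold BalancedTensor.tmul
  rw [← sub_eq_zero, ← map_sub, Submodule.mkQ_apply, Submodule.Quotient.mk_eq_zero]
  exact Submodule.subset_span ⟨m, r, n, rfl⟩

theorem BalancedTensor.smul_tmul' (s : S) (m : M) (n : N) :
    s • BalancedTensor.tmul S R m n = BalancedTensor.tmul S R (s • m) n := by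
  unfold BalancedTensor.tmul
  rw [← map_smul, TensorProduct.smul_tmul']

variable {S R} in
theorem BalancedTensor.induction {p : BalancedTensor S R M N → Prop} (h0 : p 0)
    (ht : ∀ m n, p (BalancedTensor.tmul S R m n)) (ha : ∀ x y, p x → p y → p (x + y))
    (x : BalancedTensor S R M N) : p x := by
  obtain ⟨y, rfl⟩ := Submodule.mkQ_surjective _ x
  induction y using TensorProduct.induction_on with
  | zero => simpa using h0
  | tmul m n => exact ht m n
  | add y z hy hz => rw [map_add]; exact ha _ _ hy hz

/-- The `S`-linear map `id ⊗ g : M ⊗_R N ⟶ M ⊗_R N'`. -/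
def BalancedTensor.map (M : Type u₃) [AddCommGroup M] [Module S M] [Module Rᵐᵒᵖ M]
    [SMulCommClass S Rᵐᵒᵖ M] {N N' : Type u₄} [AddCommGroup N] [Module R N] [AddCommGroup N']
    [Module R N'] (g : N →ₗ[R] N') : BalancedTensor S R M N →ₗ[S] BalancedTensor S R M N' :=
  Submodule.mapQ (balancedRelations S R M N) (balancedRelations S R M N')
    (TensorProduct.AlgebraTensorModule.map (LinearMap.id : M →ₗ[S] M)
      g.toAddMonoidHom.toIntLinearMap)
    (by
      unfold balancedRelations
      rw [Submodule.span_le]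
      rintro _ ⟨m, r, n, rfl⟩
      refine Submodule.subset_span ⟨m, r, g n, ?_⟩
      simp)

@[simp]
theorem BalancedTensor.map_tmul {N N' : Type u₄} [AddCommGroup N] [Module R N] [AddCommGroup N']
    [Module R N'] (g : N →ₗ[R] N') (m : M) (n : N) :
    BalancedTensor.map S R M g (BalancedTensor.tmul S R m n) =
      BalancedTensor.tmul S R m (g n) := by
  simp [BalancedTensor.map, BalancedTensor.tmul]

theorem BalancedTensor.map_id {N : Type u₄} [AddCommGroup N] [Module R N] :
    BalancedTensor.map S R M (LinearMap.id : N →ₗ[R] N) = LinearMap.id := by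
  refine LinearMap.ext fun x => ?_
  induction x using BalancedTensor.induction with
  | h0 => simp
  | ht m n => simp
  | ha x y hx hy => rw [map_add, map_add, hx, hy]

theorem BalancedTensor.map_comp {N N' N'' : Type u₄} [AddCommGroup N] [Module R N]
    [AddCommGroup N'] [Module R N'] [AddCommGroup N''] [Module R N''] (g : N' →ₗ[R] N'')
    (f : N →ₗ[R] N') :
    BalancedTensor.map S R M (g.comp f) =
      (BalancedTensor.map S R M g).comp (BalancedTensor.map S R M f) := by
  refine LinearMap.ext fun x => ?_
  induction x using BalancedTensor.induction with
  | h0 => simp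
  | ht m n => simp
  | ha x y hx hy => rw [map_add, map_add, hx, hy]

end BalancedTensor

universe v

noncomputable section

namespace WittWhittaker

set_option linter.unusedSectionVars false

attribute [local instance 100] LieRing.ofAssociativeRing

/-- The Witt algebra `W_n = Der ℂ[t_1, …, t_n]`, with the commutator bracket. -/
abbrev Witt (n : ℕ) : Type :=
  Derivation ℂ (MvPolynomial (Fin n) ℂ) (MvPolynomial (Fin n) ℂ)

/-- `∂_i = ∂/∂t_i`. -/
def del {n : ℕ} (i : Fin n) : Witt n := MvPolynomial.pderiv i

/-- `h_i = t_i ∂_i`. -/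
def euler {n : ℕ} (i : Fin n) : Witt n := (MvPolynomial.X i : MvPolynomial (Fin n) ℂ) • del i

theorem del_lie_del {n : ℕ} (i j : Fin n) : ⁅del i, del j⁆ = 0 := by
  apply MvPolynomial.derivation_ext
  intro k
  classical
  simp only [Derivation.commutator_apply, del, MvPolynomial.pderiv_X, Pi.single_apply]
  split_ifs <;> simp

theorem span_del_lie {n : ℕ} {x y : Witt n}
    (hx : x ∈ Submodule.span ℂ (Set.range (del (n := n))))
    (hy : y ∈ Submodule.span ℂ (Set.range (del (n := n)))) : ⁅x, y⁆ = 0 := by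
  induction hx, hy using Submodule.span_induction₂ with
  | mem_mem x y hx hy =>
    obtain ⟨i, rfl⟩ := hx
    obtain ⟨j, rfl⟩ := hy
    exact del_lie_del i j
  | zero_left y hy => exact zero_lie y
  | zero_right x hx => exact lie_zero x
  | add_left x y z _ _ _ hx hy => exact (add_lie x y z).trans (by rw [hx, hy, add_zero])
  | add_right x y z _ _ _ hx hy => exact (lie_add x y z).trans (by rw [hx, hy, add_zero])
  | smul_left r x y _ _ h => exact (smul_lie r x y).trans (by rw [h, smul_zero])
  | smul_right r x y _ _ h => exact (lie_smul r x y).trans (by rw [h, smul_zero])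

/-- The abelian Lie subalgebra `Δ_n = span {∂_1, …, ∂_n}` of `W_n`. -/
def Delta (n : ℕ) : LieSubalgebra ℂ (Witt n) where
  toSubmodule := Submodule.span ℂ (Set.range (del (n := n)))
  lie_mem' hx hy := by
    rw [span_del_lie hx hy]
    exact Submodule.zero_mem _

theorem del_mem_Delta {n : ℕ} (i : Fin n) : del i ∈ Delta n :=
  Submodule.subset_span ⟨i, rfl⟩

/-- The Lie algebra homomorphism `φ_a : Δ_n → ℂ` with `φ_a(∂_i) = a_i`. -/
def phi {n : ℕ} (a : Fin n → ℂ) : Delta n →ₗ⁅ℂ⁆ ℂ where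
  toFun x := ∑ i, a i * MvPolynomial.constantCoeff ((x : Witt n) (MvPolynomial.X i))
  map_add' x y := by simp [mul_add, Finset.sum_add_distrib]
  map_smul' c x := by
    change ∑ i, a i * MvPolynomial.constantCoeff (c • (x : Witt n) (MvPolynomial.X i)) = _
    simp only [RingHom.id_apply, smul_eq_mul, Finset.mul_sum, MvPolynomial.smul_eq_C_mul, map_mul,
      MvPolynomial.constantCoeff_C]
    exact Finset.sum_congr rfl fun i _ => by ring
  map_lie' {x y} := by
    rw [LieSubalgebra.coe_bracket, span_del_lie x.2 y.2, LieRing.of_associative_ring_bracket,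
      mul_comm, sub_self]
    simp

theorem phi_del {n : ℕ} (a : Fin n → ℂ) (i : Fin n) : phi a ⟨del i, del_mem_Delta i⟩ = a i := by
  classical
  change ∑ j, a j * MvPolynomial.constantCoeff (del i (MvPolynomial.X j)) = a i
  simp only [del, MvPolynomial.pderiv_X, Pi.single_apply]
  simp [apply_ite]

/-- The enveloping algebra `U(W_n)`. -/
abbrev UW (n : ℕ) : Type := UniversalEnvelopingAlgebra ℂ (Witt n)

/-- The enveloping algebra `U(Δ_n)`. -/
abbrev UDelta (n : ℕ) : Type := UniversalEnvelopingAlgebra ℂ (Delta n)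

/-- The canonical map `W_n → U(W_n)`. -/
def toUW {n : ℕ} : Witt n →ₗ⁅ℂ⁆ UW n := UniversalEnvelopingAlgebra.ι ℂ

/-- The algebra homomorphism `U(Δ_n) → U(W_n)` induced by the inclusion. -/
def inclU (n : ℕ) : UDelta n →ₐ[ℂ] UW n :=
  UniversalEnvelopingAlgebra.lift ℂ (toUW.comp (Delta n).incl)

/-- `U(W_n)` is a right `U(Δ_n)`-module by right multiplication. -/
instance instRightUDelta (n : ℕ) : Module (UDelta n)ᵐᵒᵖ (UW n) :=
  Module.compHom (UW n) (inclU n).toRingHom.op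

theorem op_smul_UW {n : ℕ} (r : UDelta n) (u : UW n) : op r • u = u * inclU n r := rfl

instance (n : ℕ) : SMulCommClass (UW n) (UDelta n)ᵐᵒᵖ (UW n) where
  smul_comm s r u := by
    obtain ⟨r, rfl⟩ := op_surjective r
    simp only [op_smul_UW, smul_eq_mul, mul_assoc]

/-- The one-dimensional `U(Δ_n)`-module `ℂ_a`. -/
def CharModule {n : ℕ} (_a : Fin n → ℂ) : Type := ℂ

instance {n : ℕ} (a : Fin n → ℂ) : AddCommGroup (CharModule a) :=
  inferInstanceAs (AddCommGroup ℂ)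

instance {n : ℕ} (a : Fin n → ℂ) : Module (UDelta n) (CharModule a) :=
  Module.compHom ℂ (UniversalEnvelopingAlgebra.lift ℂ (phi a)).toRingHom

/-- The generator `1_a` of `ℂ_a`. -/
def charOne {n : ℕ} (a : Fin n → ℂ) : CharModule a := (1 : ℂ)

theorem smul_charModule {n : ℕ} (a : Fin n → ℂ) (r : UDelta n) (c : CharModule a) :
    r • c = (UniversalEnvelopingAlgebra.lift ℂ (phi a) r * (show ℂ from c) : ℂ) := rfl

/-- The universal Whittaker module `Q_a = U(W_n) ⊗_{U(Δ_n)} ℂ_a`. -/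
def Q {n : ℕ} (a : Fin n → ℂ) : Type := BalancedTensor (UW n) (UDelta n) (UW n) (CharModule a)

instance {n : ℕ} (a : Fin n → ℂ) : AddCommGroup (Q a) :=
  inferInstanceAs (AddCommGroup (BalancedTensor (UW n) (UDelta n) (UW n) (CharModule a)))

instance {n : ℕ} (a : Fin n → ℂ) : Module (UW n) (Q a) :=
  inferInstanceAs (Module (UW n) (BalancedTensor (UW n) (UDelta n) (UW n) (CharModule a)))

instance {n : ℕ} (a : Fin n → ℂ) : Module ℂ (Q a) :=
  Module.restrictScalars ℂ (UW n) (Q a)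

instance {n : ℕ} (a : Fin n → ℂ) : IsScalarTower ℂ (UW n) (Q a) :=
  IsScalarTower.restrictScalars ℂ (UW n) (Q a)

/-- The element `u ⊗ 1_a` of `Q_a`. -/
def Q.mk {n : ℕ} (a : Fin n → ℂ) (u : UW n) : Q a :=
  BalancedTensor.tmul (UW n) (UDelta n) u (charOne a)

/-- The algebra `H_a = End_{W_n}(Q_a)^op`. -/
abbrev H {n : ℕ} (a : Fin n → ℂ) : Type := (Module.End (UW n) (Q a))ᵐᵒᵖ

/-- `Q_a` is a right module over `H_a = End_{W_n}(Q_a)^op`: an endomorphism `f`, seen as an element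
of `H_a`, sends `q` to `f q`. -/
instance instRightH {n : ℕ} (a : Fin n → ℂ) : Module (H a)ᵐᵒᵖ (Q a) :=
  Module.compHom (Q a) (RingEquiv.opOp (Module.End (UW n) (Q a))).symm.toRingHom

theorem op_op_smul_Q {n : ℕ} (a : Fin n → ℂ) (f : Module.End (UW n) (Q a)) (q : Q a) :
    (op (op f) : (H a)ᵐᵒᵖ) • q = f q := rfl

instance {n : ℕ} (a : Fin n → ℂ) : SMulCommClass (UW n) (H a)ᵐᵒᵖ (Q a) where
  smul_comm u r q := by
    obtain ⟨r, rfl⟩ := op_surjective r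
    obtain ⟨f, rfl⟩ := op_surjective r
    simp only [op_op_smul_Q, map_smul]

/-- The monomial `h^m = h_1^{m_1} ⋯ h_n^{m_n}` in `U(W_n)`. -/
def hMonomial {n : ℕ} (m : Fin n → ℕ) : UW n :=
  (List.ofFn fun i : Fin n => toUW (euler i) ^ m i).prod

/-! ### Whittaker vectors -/

section Wh

variable {n : ℕ} (a : Fin n → ℂ) (M : Type v) [AddCommGroup M] [Module (UW n) M] [Module ℂ M]
  [IsScalarTower ℂ (UW n) M]

/-- The space `Wh_a(M)` of Whittaker vectors of a `W_n`-module `M`. -/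
def Wh : Submodule ℂ M where
  carrier := {w | ∀ x : Delta n, toUW (x : Witt n) • w = phi a x • w}
  add_mem' hv hw x := by rw [smul_add, smul_add, hv x, hw x]
  zero_mem' x := by simp
  smul_mem' c w hw x := by rw [smul_comm, hw x, smul_comm]

variable {a M}

theorem inclU_smul {w : M} (hw : w ∈ Wh a M) (r : UDelta n) :
    inclU n r • w = UniversalEnvelopingAlgebra.lift ℂ (phi a) r • w := by
  let A : Subalgebra ℂ (UDelta n) :=
    { carrier := {r | inclU n r • w = UniversalEnvelopingAlgebra.lift ℂ (phi a) r • w}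
      mul_mem' := fun {r s} hr hs => by
        simp only [Set.mem_ofPred_eq, map_mul, mul_smul] at *
        rw [hs, smul_comm, hr, smul_comm]
      add_mem' := fun {r s} hr hs => by
        simp only [Set.mem_ofPred_eq, map_add, add_smul] at *
        rw [hr, hs]
      algebraMap_mem' := fun c => by
        simp only [Set.mem_ofPred_eq, AlgHom.commutes, algebraMap_smul] }
  let f : Delta n →ₗ⁅ℂ⁆ A :=
    { toFun := fun x => ⟨UniversalEnvelopingAlgebra.ι ℂ x, by
        change inclU n _ • w = _ • w
        rw [inclU, UniversalEnvelopingAlgebra.lift_ι_apply, UniversalEnvelopingAlgebra.lift_ι_apply]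
        exact hw x⟩
      map_add' := fun x y => Subtype.ext (map_add _ x y)
      map_smul' := fun c x => Subtype.ext (map_smul _ c x)
      map_lie' := fun {x y} => Subtype.ext (LieHom.map_lie _ x y) }
  have key : A.val.comp (UniversalEnvelopingAlgebra.lift ℂ f) = AlgHom.id ℂ (UDelta n) := by
    ext x
    simp [f]
  have h := (UniversalEnvelopingAlgebra.lift ℂ f r).2
  have h2 : ((UniversalEnvelopingAlgebra.lift ℂ f r : A) : UDelta n) = r :=
    DFunLike.congr_fun key r
  rw [h2] at h
  exact h

/-- The homomorphism `Q_a → M` of `W_n`-modules with `u ⊗ 1_a ↦ u • w`, for a Whittaker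
vector `w` of `M`. -/
def ofWh (w : Wh a M) : Q a →ₗ[UW n] M :=
  (balancedRelations (UW n) (UDelta n) (UW n) (CharModule a)).liftQ
    (TensorProduct.AlgebraTensorModule.lift
      { toFun := fun u =>
          { toFun := fun c : CharModule a => u • ((show ℂ from c) • (w : M))
            map_add' := fun c d => by
              change u • (((show ℂ from c) + (show ℂ from d)) • (w : M)) = _
              rw [add_smul, smul_add]
            map_smul' := fun k c => by
              change u • ((k • (show ℂ from c)) • (w : M)) = k • _
              rw [smul_assoc, smul_comm] }
        map_add' := fun u v => LinearMap.ext fun c => add_smul u v _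
        map_smul' := fun s u => LinearMap.ext fun c => mul_smul s u _ })
    (by
      unfold balancedRelations
      rw [Submodule.span_le]
      rintro _ ⟨u, r, c, rfl⟩
      rw [SetLike.mem_coe, LinearMap.mem_ker, map_sub, sub_eq_zero]
      change (u * inclU n r) • ((show ℂ from c) • (w : M)) =
        u • ((UniversalEnvelopingAlgebra.lift ℂ (phi a) r * (show ℂ from c)) • (w : M))
      rw [mul_smul, smul_comm (inclU n r), inclU_smul w.2, smul_smul, mul_comm])

theorem ofWh_mk (w : Wh a M) (u : UW n) : ofWh w (Q.mk a u) = u • (w : M) := by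
  change u • ((1 : ℂ) • (w : M)) = _
  rw [one_smul]

theorem Q.smul_mk (s u : UW n) : s • Q.mk a u = Q.mk a (s * u) :=
  BalancedTensor.smul_tmul' _ _ s u _

theorem Q.tmul_eq_mk (u : UW n) (c : ℂ) :
    BalancedTensor.tmul (UW n) (UDelta n) u (show CharModule a from c) = Q.mk a (c • u) := by
  have h := BalancedTensor.op_smul_tmul (UW n) (UDelta n) u (algebraMap ℂ (UDelta n) c) (charOne a)
  rw [op_smul_UW, AlgHom.commutes, ← Algebra.commutes, ← Algebra.smul_def, smul_charModule,
    AlgHom.commutes] at h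
  refine Eq.symm (h.trans ?_)
  congr 1
  exact mul_one c

theorem Q.mk_surjective : Function.Surjective (Q.mk a) := by
  intro q
  induction q using BalancedTensor.induction with
  | h0 => exact ⟨0, by
      change BalancedTensor.tmul (UW n) (UDelta n) 0 (charOne a) = 0
      simp [BalancedTensor.tmul]⟩
  | ht u c => exact ⟨_, (Q.tmul_eq_mk u c).symm⟩
  | ha x y hx hy =>
    obtain ⟨u, rfl⟩ := hx
    obtain ⟨v, rfl⟩ := hy
    refine ⟨u + v, ?_⟩
    change BalancedTensor.tmul (UW n) (UDelta n) (u + v) (charOne a) =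
      BalancedTensor.tmul (UW n) (UDelta n) u (charOne a) +
        BalancedTensor.tmul (UW n) (UDelta n) v (charOne a)
    simp [BalancedTensor.tmul, TensorProduct.add_tmul]

theorem Q.hom_ext {f g : Q a →ₗ[UW n] M} (h : f (Q.mk a 1) = g (Q.mk a 1)) : f = g := by
  ext q
  obtain ⟨u, rfl⟩ := Q.mk_surjective q
  rw [← mul_one u, ← Q.smul_mk, map_smul, map_smul, h]

theorem Q.mk_one_mem : Q.mk a 1 ∈ Wh a (Q a) := by
  intro x
  have h := BalancedTensor.op_smul_tmul (UW n) (UDelta n) (1 : UW n)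
    (UniversalEnvelopingAlgebra.ι ℂ x) (charOne a)
  rw [op_smul_UW, one_mul, inclU, UniversalEnvelopingAlgebra.lift_ι_apply, smul_charModule,
    UniversalEnvelopingAlgebra.lift_ι_apply] at h
  rw [Q.smul_mk, mul_one]
  refine h.trans ?_
  refine (Q.tmul_eq_mk 1 _).trans ?_
  rw [← algebraMap_smul (UW n) (phi a x) (Q.mk a 1), Q.smul_mk, mul_one,
    ← Algebra.algebraMap_eq_smul_one]
  congr 2
  exact mul_one _

theorem map_mem_Wh {N : Type*} [AddCommGroup N] [Module (UW n) N] [Module ℂ N]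
    [IsScalarTower ℂ (UW n) N] (f : M →ₗ[UW n] N) {w : M} (hw : w ∈ Wh a M) : f w ∈ Wh a N := by
  intro x
  rw [← map_smul, hw x, f.map_smul_of_tower]

/-- `Wh_a(M)` is a left module over `H_a = End_{W_n}(Q_a)^op`: identify a Whittaker vector `w` with
the homomorphism `Q_a → M` that sends `1 ⊗ 1_a` to `w`, and let endomorphisms of `Q_a` act by
precomposition. -/
instance : SMul (H a) (Wh a M) where
  smul h w := ⟨ofWh w (h.unop (Q.mk a 1)), map_mem_Wh _ (map_mem_Wh _ Q.mk_one_mem)⟩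

theorem coe_H_smul (h : H a) (w : Wh a M) : ((h • w : Wh a M) : M) = ofWh w (h.unop (Q.mk a 1)) :=
  rfl

theorem ofWh_H_smul (h : H a) (w : Wh a M) : ofWh (h • w) = (ofWh w).comp h.unop := by
  apply Q.hom_ext
  rw [ofWh_mk, one_smul, coe_H_smul, LinearMap.comp_apply]

theorem ofWh_add (v w : Wh a M) : ofWh (v + w) = ofWh v + ofWh w := by
  apply Q.hom_ext
  simp [ofWh_mk]

theorem ofWh_zero : ofWh (0 : Wh a M) = 0 := by
  apply Q.hom_ext
  simp [ofWh_mk]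

instance : Module (H a) (Wh a M) where
  one_smul w := Subtype.ext (by
    rw [coe_H_smul, unop_one, Module.End.one_apply, ofWh_mk, one_smul])
  mul_smul g h w := Subtype.ext (by
    rw [coe_H_smul, coe_H_smul, ofWh_H_smul]
    rfl)
  smul_zero h := Subtype.ext (by
    rw [coe_H_smul, ofWh_zero]
    rfl)
  smul_add h v w := Subtype.ext (by
    rw [coe_H_smul, ofWh_add]
    rfl)
  add_smul g h w := Subtype.ext (by
    rw [coe_H_smul]
    exact map_add (ofWh w) (g.unop (Q.mk a 1)) (h.unop (Q.mk a 1)))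
  zero_smul w := Subtype.ext (by
    rw [coe_H_smul]
    exact map_zero (ofWh w))

/-- The `H_a`-linear map `Wh_a(M) → Wh_a(N)` obtained by restricting a homomorphism `M → N` of
`W_n`-modules. -/
def whMap {N : Type*} [AddCommGroup N] [Module (UW n) N] [Module ℂ N]
    [IsScalarTower ℂ (UW n) N] (f : M →ₗ[UW n] N) : Wh a M →ₗ[H a] Wh a N where
  toFun w := ⟨f w, map_mem_Wh f w.2⟩
  map_add' v w := Subtype.ext (map_add f _ _)
  map_smul' h w := Subtype.ext (by
    change (f.comp (ofWh w)) (h.unop (Q.mk a 1)) =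
      ofWh (⟨f w, map_mem_Wh f w.2⟩ : Wh a N) (h.unop (Q.mk a 1))
    refine LinearMap.congr_fun (Q.hom_ext ?_) _
    rw [LinearMap.comp_apply, ofWh_mk, ofWh_mk, one_smul, one_smul])

end Wh

/-! ### The categories and the functors -/

open scoped ModuleCat

variable {n : ℕ} (a : Fin n → ℂ)

/-- The action of `Δ_n` on the `W_n`-module `M` is locally finite, i.e. `M` is a Whittaker
module. -/
def IsWhittaker (M : ModuleCat.{v} (UW n)) : Prop :=
  ∀ w : M, ∃ F : Submodule ℂ M, FiniteDimensional ℂ F ∧ w ∈ F ∧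
    ∀ x : Delta n, ∀ y ∈ F, toUW (x : Witt n) • y ∈ F

/-- The `W_n`-module `M` is of type `φ_a`: every vector is killed, for some `k`, by all
`(x - φ_a(x))^k` with `x ∈ Δ_n`. -/
def IsOfType (M : ModuleCat.{v} (UW n)) : Prop :=
  ∀ w : M, ∃ k : ℕ, ∀ x : Delta n,
    (toUW (x : Witt n) - algebraMap ℂ (UW n) (phi a x)) ^ k • w = 0

/-- The objects of `Ω_a^W`: Whittaker `W_n`-modules of type `φ_a` whose space of Whittaker vectors
is finite-dimensional. -/
def Omega : ObjectProperty (ModuleCat.{v} (UW n)) := fun M =>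
  IsWhittaker M ∧ IsOfType a M ∧ FiniteDimensional ℂ (Wh a M)

/-- The finite-dimensional `H_a`-modules. -/
def finDim : ObjectProperty (ModuleCat.{v} (H a)) := fun V => FiniteDimensional ℂ V

/-- The functor `M ↦ Wh_a(M)` from `W_n`-modules to `H_a`-modules. -/
def whFunctor : ModuleCat.{v} (UW n) ⥤ ModuleCat.{v} (H a) where
  obj M := ModuleCat.of (H a) (Wh a M)
  map f := ModuleCat.ofHom (whMap f.hom)

/-- The functor `V ↦ Q_a ⊗_{H_a} V` from `H_a`-modules to `W_n`-modules. -/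
def tensorFunctor : ModuleCat.{v} (H a) ⥤ ModuleCat.{v} (UW n) where
  obj V := ModuleCat.of (UW n) (BalancedTensor (UW n) (H a) (Q a) V)
  map g := ModuleCat.ofHom (BalancedTensor.map (UW n) (H a) (Q a) g.hom)
  map_id _ := ModuleCat.hom_ext (BalancedTensor.map_id (UW n) (H a))
  map_comp f g := ModuleCat.hom_ext (BalancedTensor.map_comp (UW n) (H a) g.hom f.hom)

end WittWhittaker

end

/-! Put `D_i = ∂_i - a_i`. Since `[∂_i, h_i] = ∂_i`, the bracket `[D_i, h_i]` is `D_i + a_i`, and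
`D_i` commutes with `D_j` and with `h_j` for `j ≠ i`. As `a_i ≠ 0`, this works like a deformed Weyl
algebra: on a vector `w` killed by `D_i`, `D_i^k h_i^k w = k! a_i^k w` and `D_i^(k+1) h_i^k w = 0`.
Whittaker vectors are exactly the common kernel of the `D_i`, so a Kashiwara-type argument shows
that `(w_m) ↦ ∑ h^m w_m`, on finitely supported families in `Wh_a(M)`, is injective for every `M`
(`whSum_injective`) and bijective when each `D_i` is locally nilpotent (`whSum_surjective`).

Bracketing with `∂_i` lowers the degree of polynomial coefficients, so the vectors killed by all
long products of the `D_i` form a `W_n`-submodule (`exists_smul_mem_whFiltration`). It contains the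
generator of `Q_a`, hence is all of `Q_a`. Since `Wh_a(Q_a)` is identified with `H_a`, bijectivity
of `whSum` for `Q_a` is (a); no PBW basis is needed.

For (b), every element of `Q_a ⊗ V` can be written `∑ h^m (1 ⊗ v_m)`. Comparing with the unique
expansion by Whittaker vectors gives `V ≅ Wh_a(Q_a ⊗ V)`, and the evaluation `Q_a ⊗ Wh_a(M) → M`
turns into `whSum` for `M`, hence is bijective. -/

/-! ### Systems of raising and lowering operators -/

section RaisingLowering

variable {K V : Type*} [Field K] [AddCommGroup V] [Module K V]

/-- Operators `D i` and `h i` with the commutation relations of `∂_i - a_i` and `t_i ∂_i`. -/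
structure IsRaisingLowering {n : ℕ} (c : Fin n → K) (D h : Fin n → Module.End K V) : Prop where
  ne_zero : ∀ i, c i ≠ 0
  comm : ∀ i j, Commute (D i) (D j)
  comm_of_ne : ∀ i j, i ≠ j → Commute (D i) (h j)
  rel : ∀ i, D i * h i = h i * D i + D i + algebraMap K _ (c i)

theorem IsRaisingLowering.tail {n : ℕ} {c : Fin (n + 1) → K} {D h : Fin (n + 1) → Module.End K V}
    (H : IsRaisingLowering c D h) :
    IsRaisingLowering (fun i => c (Fin.succ i)) (fun i => D (Fin.succ i))
      (fun i => h (Fin.succ i)) where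
  ne_zero _ := H.ne_zero _
  comm _ _ := H.comm _ _
  comm_of_ne _ _ hij := H.comm_of_ne _ _ (fun h => hij (Fin.succ_injective _ h))
  rel _ := H.rel _

/-- The ordered monomial `h_1^{m_1} ⋯ h_n^{m_n}` in operators. -/
def opMonomial {n : ℕ} (h : Fin n → Module.End K V) (m : Fin n → ℕ) : Module.End K V :=
  (List.ofFn fun i => h i ^ m i).prod

theorem opMonomial_succ {n : ℕ} (h : Fin (n + 1) → Module.End K V) (m : Fin (n + 1) → ℕ) :
    opMonomial h m = h 0 ^ m 0 * opMonomial (fun i => h i.succ) (fun i => m i.succ) := by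
  rw [opMonomial, List.ofFn_succ, List.prod_cons, opMonomial]

theorem opMonomial_zero {n : ℕ} (h : Fin n → Module.End K V) : opMonomial h 0 = 1 := by
  induction n with
  | zero => rfl
  | succ n ih =>
    rw [opMonomial_succ, Pi.zero_apply, pow_zero, one_mul]
    exact ih _

theorem opMonomial_commute {n : ℕ} {T : Module.End K V} {h : Fin n → Module.End K V}
    (hT : ∀ i, Commute T (h i)) (m : Fin n → ℕ) : Commute T (opMonomial h m) := by
  induction n with
  | zero => exact Commute.one_right T
  | succ n ih =>
    rw [opMonomial_succ]
    exact ((hT 0).pow_right _).mul_right (ih (fun i => hT i.succ) _)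

variable [CharZero K]

/-! ### One pair of operators -/

/-- Each of the `k + 1` factors `D`, on passing `h`, leaves behind `D + c`. The exponent `k + 1`
avoids a `D ^ (k - 1)`. -/
theorem lowering_pow_mul_raising {D h : Module.End K V} {c : K}
    (hD : D * h = h * D + D + algebraMap K _ c) (k : ℕ) :
    D ^ (k + 1) * h = (h + (k + 1 : K) • 1) * D ^ (k + 1) + ((k + 1 : K) * c) • D ^ k := by
  induction k with
  | zero => simp [hD, add_mul, Algebra.algebraMap_eq_smul_one]
  | succ k ih =>
    rw [pow_succ', mul_assoc, ih, mul_add, mul_smul_comm, ← pow_succ', ← mul_assoc, mul_add, hD,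
      Algebra.algebraMap_eq_smul_one]
    simp only [add_mul, mul_assoc, smul_mul_assoc, one_mul, mul_smul_comm, mul_one, Nat.cast_add,
      Nat.cast_one]
    module

theorem lowering_pow_raising_pow {D h : Module.End K V} {c : K}
    (hD : D * h = h * D + D + algebraMap K _ c) {w : V} (hw : D w = 0) (k : ℕ) :
    (D ^ k) ((h ^ k) w) = (k.factorial * c ^ k : K) • w ∧ (D ^ (k + 1)) ((h ^ k) w) = 0 := by
  induction k with
  | zero => simp [hw]
  | succ k ih =>
    have key (j : ℕ) (x : V) := LinearMap.congr_fun (lowering_pow_mul_raising hD j) x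
    simp only [Module.End.mul_apply, LinearMap.add_apply, LinearMap.smul_apply] at key
    have h0 : (D ^ (k + 1 + 1)) ((h ^ k) w) = 0 := by
      rw [pow_succ', Module.End.mul_apply, ih.2, map_zero]
    rw [pow_succ' h k, Module.End.mul_apply]
    constructor
    · rw [key, ih.1, ih.2, Nat.factorial_succ]
      push_cast
      simp only [map_zero, zero_add]
      module
    · rw [key, ih.2, h0]
      simp

/-- `D ^ N` kills every term below the top one and multiplies the top coefficient by `N! c^N`, which
is nonzero in characteristic zero; so coefficients are peeled off from the top. -/
theorem raising_pow_independent {D h : Module.End K V} {c : K} (hc : c ≠ 0)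
    (hD : D * h = h * D + D + algebraMap K _ c) (N : ℕ) (f : ℕ → V) (hf : ∀ k, D (f k) = 0)
    (hs : ∑ k ∈ Finset.range N, (h ^ k) (f k) = 0) : ∀ k < N, f k = 0 := by
  induction N with
  | zero => simp
  | succ N ih =>
    have hN : f N = 0 := by
      have := congrArg (D ^ N) hs
      rw [map_sum, Finset.sum_range_succ, Finset.sum_eq_zero, zero_add,
        (lowering_pow_raising_pow hD (hf N) N).1, map_zero] at this
      · exact (smul_eq_zero.mp this).resolve_left
          (mul_ne_zero (Nat.cast_ne_zero.mpr N.factorial_ne_zero) (pow_ne_zero _ hc))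
      · intro k hk
        obtain ⟨j, rfl⟩ := Nat.exists_eq_add_of_lt (Finset.mem_range.mp hk)
        rw [add_right_comm, add_comm, pow_add, Module.End.mul_apply,
          (lowering_pow_raising_pow hD (hf k) k).2, map_zero]
    rw [Finset.sum_range_succ, hN, map_zero, add_zero] at hs
    intro k hk
    rcases Nat.lt_succ_iff_lt_or_eq.mp hk with hk | rfl
    · exact ih hs k hk
    · exact hN

/-- The stable subspace `p` keeps track of where the coefficients live; with several operators it is
cut down to the common kernel of those already treated. -/
theorem mem_span_raising_pow {D h : Module.End K V} {c : K} (hc : c ≠ 0)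
    (hD : D * h = h * D + D + algebraMap K _ c) (p : Submodule K V) (hpD : ∀ x ∈ p, D x ∈ p)
    (hph : ∀ x ∈ p, h x ∈ p) (N : ℕ) :
    ∀ x ∈ p, (D ^ N) x = 0 →
      x ∈ Submodule.span K {y | ∃ (k : ℕ) (w : V), w ∈ p ∧ D w = 0 ∧ y = (h ^ k) w} := by
  have pow_mem {T : Module.End K V} (hT : ∀ x ∈ p, T x ∈ p) (k : ℕ) : ∀ x ∈ p, (T ^ k) x ∈ p := by
    induction k with
    | zero => simp
    | succ k ih =>
      intro x hx
      rw [pow_succ', Module.End.mul_apply]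
      exact hT _ (ih x hx)
  induction N with
  | zero =>
    intro x _ hx
    rw [pow_zero, Module.End.one_apply] at hx
    rw [hx]
    exact Submodule.zero_mem _
  | succ N ih =>
    intro x hx h0
    set e : K := N.factorial * c ^ N with he
    have he0 : e ≠ 0 := mul_ne_zero (Nat.cast_ne_zero.mpr N.factorial_ne_zero) (pow_ne_zero _ hc)
    -- By `D ^ N h ^ N w = e • w`, this is the coefficient for which `x - h ^ N w` is already killed
    -- by `D ^ N`.
    set w := e⁻¹ • (D ^ N) x with hw
    have hwp : w ∈ p := p.smul_mem _ (pow_mem hpD N x hx)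
    have hDw : D w = 0 := by
      rw [hw, map_smul, ← Module.End.mul_apply, ← pow_succ', h0, smul_zero]
    have h1 : (D ^ N) (x - (h ^ N) w) = 0 := by
      rw [map_sub, (lowering_pow_raising_pow hD hDw N).1, ← he, hw, smul_smul,
        mul_inv_cancel₀ he0, one_smul, sub_self]
    rw [← sub_add_cancel x ((h ^ N) w)]
    exact Submodule.add_mem _ (ih _ (p.sub_mem hx (pow_mem hph N w hwp)) h1)
      (Submodule.subset_span ⟨N, w, hwp, hDw, rfl⟩)

/-! ### Several commuting pairs -/

theorem IsRaisingLowering.independent_box {n : ℕ} {c : Fin n → K} {D h : Fin n → Module.End K V}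
    (H : IsRaisingLowering c D h) (N : ℕ) (f : (Fin n → Fin N) → V)
    (hf : ∀ m i, D i (f m) = 0)
    (hs : ∑ m, opMonomial h (fun i => m i) (f m) = 0) (m : Fin n → Fin N) : f m = 0 := by
  induction n with
  | zero =>
    rw [Fintype.sum_unique] at hs
    rw [Subsingleton.elim m default]
    exact hs
  | succ n ih =>
    rw [← (Fin.consEquiv fun _ : Fin (n + 1) => Fin N).sum_comp, Fintype.sum_prod_type] at hs
    -- Coefficient of `h_0^k`, itself a sum of monomials in the remaining `h_i`. Since `D 0`
    -- commutes with those, it lies in the kernel of `D 0`, so the one-variable result applies; the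
    -- value for `k ≥ N` is never used.
    let g : ℕ → V := fun k => if hk : k < N then
      ∑ m' : Fin n → Fin N, opMonomial (fun i => h i.succ) (fun i => m' i)
        (f (Fin.cons ⟨k, hk⟩ m')) else 0
    have hg : ∀ k, D 0 (g k) = 0 := by
      intro k
      simp only [g]
      split_ifs with hk
      · rw [map_sum]
        refine Finset.sum_eq_zero fun m' _ => ?_
        rw [← Module.End.mul_apply,
          (opMonomial_commute (fun i => H.comm_of_ne 0 i.succ (Fin.succ_ne_zero i).symm) _).eq,
          Module.End.mul_apply, hf, map_zero]
      · exact map_zero _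
    have hsum : ∑ k ∈ Finset.range N, (h 0 ^ k) (g k) = 0 := by
      rw [Finset.sum_range, ← hs]
      refine Finset.sum_congr rfl fun k _ => ?_
      simp only [g, k.2, dite_true, map_sum]
      refine Finset.sum_congr rfl fun m' _ => ?_
      rw [opMonomial_succ]
      rfl
    have h0 := raising_pow_independent (H.ne_zero 0) (H.rel 0) N g hg hsum (m 0) (m 0).2
    simp only [g, (m 0).2, dite_true] at h0
    have := ih H.tail (fun m' => f (Fin.cons (m 0) m')) (fun m' i => hf _ _) h0 (fun i => m i.succ)
    rwa [show Fin.cons (m 0) (fun i => m i.succ) = m from Fin.cons_self_tail m] at this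

theorem IsRaisingLowering.independent {n : ℕ} {c : Fin n → K} {D h : Fin n → Module.End K V}
    (H : IsRaisingLowering c D h) (s : Finset (Fin n → ℕ)) (f : (Fin n → ℕ) → V)
    (hf : ∀ m i, D i (f m) = 0) (hs : ∑ m ∈ s, opMonomial h m (f m) = 0) :
    ∀ m ∈ s, f m = 0 := by
  classical
  obtain ⟨N, hN⟩ : ∃ N, ∀ m ∈ s, ∀ i, m i < N := by
    refine ⟨s.sup (fun m => Finset.univ.sup m) + 1, fun m hm i => Nat.lt_succ_of_le ?_⟩
    exact (Finset.le_sup (f := m) (Finset.mem_univ i)).trans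
      (Finset.le_sup (f := fun m : Fin n → ℕ => Finset.univ.sup m) hm)
  -- The family on `s` is extended by zero to a box containing `s`.
  have key := H.independent_box N
    (fun m => if (fun i => (m i : ℕ)) ∈ s then f (fun i => m i) else 0)
    (fun m i => by
      split_ifs
      · exact hf _ _
      · exact map_zero _) (by
      refine Eq.trans ?_ hs
      refine Finset.sum_bij_ne_zero (fun m _ _ i => (m i : ℕ)) ?_ ?_ ?_ ?_
      · intro m _ h0
        by_contra hm
        exact h0 (by rw [if_neg hm, map_zero])
      · intro m _ _ m' _ _ h
        funext i
        exact Fin.ext (congrFun h i)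
      · intro m hm h0
        refine ⟨fun i => ⟨m i, hN m hm i⟩, Finset.mem_univ _, ?_, rfl⟩
        simpa [hm] using h0
      · intro m _ h0
        by_cases hm : (fun i => (m i : ℕ)) ∈ s
        · rw [if_pos hm]
        · exact absurd (by rw [if_neg hm, map_zero]) h0)
  intro m hm
  simpa [hm] using key (fun i => ⟨m i, hN m hm i⟩)

theorem IsRaisingLowering.mem_span {n : ℕ} {c : Fin n → K} {D h : Fin n → Module.End K V}
    (H : IsRaisingLowering c D h) (hnil : ∀ i x, ∃ k, (D i ^ k) x = 0) (p : Submodule K V)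
    (hpD : ∀ i, ∀ x ∈ p, D i x ∈ p) (hph : ∀ i, ∀ x ∈ p, h i x ∈ p) {x : V} (hx : x ∈ p) :
    x ∈ Submodule.span K
      {y | ∃ (m : Fin n → ℕ) (w : V), w ∈ p ∧ (∀ i, D i w = 0) ∧ y = opMonomial h m w} := by
  induction n generalizing p x with
  | zero => exact Submodule.subset_span ⟨0, x, hx, fun i => i.elim0, by rw [opMonomial_zero]; rfl⟩
  | succ n ih =>
    obtain ⟨k, hk⟩ := hnil 0 x
    have h1 := mem_span_raising_pow (H.ne_zero 0) (H.rel 0) p (hpD 0) (hph 0) k x hx hk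
    refine Submodule.span_le.mpr ?_ h1
    rintro _ ⟨k, w, hwp, hw, rfl⟩
    -- The remaining `D i` and `h i` commute with `D 0`, so they preserve its kernel; expanding
    -- inside this kernel makes the new coefficients killed by `D 0` as well.
    have h2 := ih H.tail (fun i => hnil i.succ) (p ⊓ LinearMap.ker (D 0))
      (fun i x hx => ⟨hpD _ _ hx.1, by
        rw [SetLike.mem_coe, LinearMap.mem_ker, ← Module.End.mul_apply, (H.comm _ _).eq,
          Module.End.mul_apply, LinearMap.mem_ker.mp hx.2, map_zero]⟩)
      (fun i x hx => ⟨hph _ _ hx.1, by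
        rw [SetLike.mem_coe, LinearMap.mem_ker, ← Module.End.mul_apply,
          (H.comm_of_ne 0 i.succ (Fin.succ_ne_zero i).symm).eq,
          Module.End.mul_apply, LinearMap.mem_ker.mp hx.2, map_zero]⟩) ⟨hwp, hw⟩
    have h3 := Submodule.mem_map_of_mem (f := h 0 ^ k) h2
    rw [Submodule.map_span] at h3
    refine Submodule.span_mono ?_ h3
    rintro _ ⟨_, ⟨m, u, hu, hDu, rfl⟩, rfl⟩
    refine ⟨Fin.cons k m, u, hu.1, fun i => ?_, ?_⟩
    · refine Fin.cases ?_ (fun i => ?_) i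
      · exact hu.2
      · exact hDu i
    · rw [opMonomial_succ]
      rfl

end RaisingLowering

/-! ### Witt algebra -/
noncomputable section

namespace WittWhittaker

attribute [local instance 100] LieRing.ofAssociativeRing

theorem toUW_lie {n : ℕ} (x y : Witt n) : toUW ⁅x, y⁆ = toUW x * toUW y - toUW y * toUW x :=
  LieHom.map_lie _ x y

theorem del_lie_apply_X {n : ℕ} (i j : Fin n) (x : Witt n) :
    ⁅del i, x⁆ (MvPolynomial.X j) = MvPolynomial.pderiv i (x (MvPolynomial.X j)) := by
  classical
  rw [Derivation.commutator_apply, del, MvPolynomial.pderiv_X, Pi.single_apply]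
  split_ifs <;> simp

theorem del_lie_euler {n : ℕ} (i j : Fin n) : ⁅del i, euler j⁆ = if i = j then del i else 0 := by
  classical
  apply MvPolynomial.derivation_ext
  intro k
  rw [del_lie_apply_X, euler, Derivation.smul_apply, del]
  by_cases hij : i = j
  · subst hij
    rw [if_pos rfl]
    by_cases hk : k = i
    · subst hk
      simp [del]
    · simp [del, MvPolynomial.pderiv_X_of_ne hk]
  · rw [if_neg hij]
    by_cases hk : k = j
    · subst hk
      simp [MvPolynomial.pderiv_X_of_ne (Ne.symm hij)]
    · simp [MvPolynomial.pderiv_X_of_ne hk]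

/-- Every iterated bracket of `x` with `d` of the `∂_i` vanishes. -/
def DelNilpotent {n : ℕ} : ℕ → Witt n → Prop
  | 0, x => x = 0
  | d + 1, x => ∀ i : Fin n, DelNilpotent d ⁅(del i : Witt n), x⁆

/-- Bracketing with `∂_i` differentiates the polynomials `x(t_j)`, so each bracket lowers by one the
bound on their degrees. -/
theorem delNilpotent_of_coeff {n : ℕ} (d : ℕ) (x : Witt n)
    (hx : ∀ (j : Fin n) (m : Fin n →₀ ℕ), d ≤ m.degree →
      MvPolynomial.coeff m (x (MvPolynomial.X j)) = 0) : DelNilpotent d x := by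
  induction d generalizing x with
  | zero =>
    refine MvPolynomial.derivation_ext fun j => ?_
    ext m
    rw [hx j m (Nat.zero_le _)]
    simp
  | succ d ih =>
    intro i
    refine ih _ fun j m hm => ?_
    rw [del_lie_apply_X, MvPolynomial.coeff_pderiv, hx, zero_mul]
    rw [map_add, Finsupp.degree_single]
    exact Nat.succ_le_succ hm

theorem exists_delNilpotent {n : ℕ} (x : Witt n) : ∃ d, DelNilpotent d x := by
  refine ⟨(Finset.univ.sup fun j => (x (MvPolynomial.X j)).totalDegree) + 1,
    delNilpotent_of_coeff _ _ fun j m hm => ?_⟩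
  refine MvPolynomial.coeff_eq_zero_of_totalDegree_lt ?_
  have := Finset.le_sup (f := fun j => (x (MvPolynomial.X j)).totalDegree) (Finset.mem_univ j)
  rw [← Finsupp.degree_apply]
  omega

/-- The elements satisfying `p` form a subalgebra containing the image of `W_n`. By the universal
property, `U(W_n)` maps into it, and followed by the inclusion this is the identity. -/
theorem UW_induction {n : ℕ} {p : UW n → Prop} (hc : ∀ c : ℂ, p (algebraMap ℂ _ c))
    (hι : ∀ x : Witt n, p (toUW x)) (hm : ∀ u v, p u → p v → p (u * v))
    (ha : ∀ u v, p u → p v → p (u + v)) (u : UW n) : p u := by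
  let A : Subalgebra ℂ (UW n) :=
    { carrier := {u | p u}
      mul_mem' := fun {u v} hu hv => hm u v hu hv
      add_mem' := fun {u v} hu hv => ha u v hu hv
      algebraMap_mem' := hc }
  let f : Witt n →ₗ⁅ℂ⁆ A :=
    { toFun := fun x => ⟨toUW x, hι x⟩
      map_add' := fun x y => Subtype.ext (map_add _ x y)
      map_smul' := fun c x => Subtype.ext (map_smul _ c x)
      map_lie' := fun {x y} => Subtype.ext (LieHom.map_lie _ x y) }
  have key : A.val.comp (UniversalEnvelopingAlgebra.lift ℂ f) = AlgHom.id ℂ (UW n) := by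
    ext x
    simp [f, toUW]
  have h := (UniversalEnvelopingAlgebra.lift ℂ f u).2
  rwa [show ((UniversalEnvelopingAlgebra.lift ℂ f u : A) : UW n) = u from
    DFunLike.congr_fun key u] at h

/-! ### Structure of Whittaker modules -/

/-- The element `∂_i - a_i` of `U(W_n)`. -/
def lowering {n : ℕ} (a : Fin n → ℂ) (i : Fin n) : UW n :=
  toUW (del i) - algebraMap ℂ (UW n) (a i)

theorem lowering_mul_toUW {n : ℕ} (a : Fin n → ℂ) (i : Fin n) (x : Witt n) :
    lowering a i * toUW x = toUW x * lowering a i + toUW ⁅del i, x⁆ := by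
  rw [toUW_lie, lowering, sub_mul, mul_sub, Algebra.commutes]
  abel

section Structure

variable {n : ℕ} (a : Fin n → ℂ) (M : Type v) [AddCommGroup M] [Module (UW n) M] [Module ℂ M]
  [IsScalarTower ℂ (UW n) M]

theorem isRaisingLowering (ha : ∀ i, a i ≠ 0) :
    IsRaisingLowering a (fun i => Algebra.lsmul ℂ ℂ M (lowering a i))
      (fun i => Algebra.lsmul ℂ ℂ M (toUW (euler i))) where
  ne_zero := ha
  comm i j := by
    refine Commute.map (f := Algebra.lsmul ℂ ℂ M) ?_
    have h : Commute (lowering a i) (toUW (del j)) := by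
      rw [commute_iff_eq, lowering_mul_toUW, del_lie_del, map_zero, add_zero]
    exact h.sub_right (Algebra.commutes _ _).symm
  comm_of_ne i j hij := by
    refine Commute.map (f := Algebra.lsmul ℂ ℂ M) ?_
    rw [commute_iff_eq, lowering_mul_toUW, del_lie_euler, if_neg hij, map_zero, add_zero]
  rel i := by
    rw [← map_mul, ← map_mul, ← AlgHom.commutes (Algebra.lsmul ℂ ℂ M : UW n →ₐ[ℂ] Module.End ℂ M), ← map_add, ← map_add,
      lowering_mul_toUW, del_lie_euler, if_pos rfl, add_assoc, lowering, sub_add_cancel]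

variable {a M}

theorem opMonomial_euler (m : Fin n → ℕ) :
    opMonomial (fun i => Algebra.lsmul ℂ ℂ M (toUW (euler i))) m =
      Algebra.lsmul ℂ ℂ M (hMonomial m) := by
  rw [opMonomial, hMonomial, map_list_prod, List.map_ofFn]
  congr 2
  funext i
  exact (map_pow _ _ _).symm

/-- `x - φ_a(x)` is linear in `x`, so the `∂_i` suffice. The case `p = ⊥` describes Whittaker
vectors; the other use takes for `p` a step of the filtration. -/
theorem toUW_sub_phi_smul_mem (p : Submodule ℂ M) {w : M} (hw : ∀ i, lowering a i • w ∈ p)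
    (x : Delta n) : (toUW (x : Witt n) - algebraMap ℂ (UW n) (phi a x)) • w ∈ p := by
  obtain ⟨x, hx⟩ := x
  change x ∈ Submodule.span ℂ (Set.range del) at hx
  induction hx using Submodule.span_induction with
  | mem x hx =>
    obtain ⟨i, rfl⟩ := hx
    rw [phi_del]
    exact hw i
  | zero =>
    rw [show (⟨0, _⟩ : Delta n) = 0 from rfl]
    simp
  | add x y hx hy h1 h2 =>
    have := p.add_mem h1 h2
    rw [show (⟨x + y, _⟩ : Delta n) = ⟨x, hx⟩ + ⟨y, hy⟩ from rfl, map_add]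
    rw [← add_smul] at this
    convert this using 2
    rw [map_add]
    change toUW (x + y) - _ = toUW x - _ + (toUW y - _)
    rw [map_add]
    abel
  | smul c x hx h1 =>
    have := p.smul_mem c h1
    rw [show (⟨c • x, _⟩ : Delta n) = c • ⟨x, hx⟩ from rfl, map_smul]
    rw [← smul_assoc] at this
    convert this using 2
    change toUW (c • x) - _ = c • (toUW x - _)
    rw [map_smul, smul_sub, Algebra.algebraMap_eq_smul_one, Algebra.algebraMap_eq_smul_one,
      smul_assoc]

theorem mem_Wh_iff {w : M} : w ∈ Wh a M ↔ ∀ i, lowering a i • w = 0 := by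
  constructor
  · intro hw i
    rw [lowering, sub_smul, algebraMap_smul, sub_eq_zero, ← phi_del a i]
    exact hw ⟨del i, del_mem_Delta i⟩
  · intro hw x
    have := toUW_sub_phi_smul_mem (a := a) (⊥ : Submodule ℂ M) (w := w) (by simpa using hw) x
    rwa [Submodule.mem_bot, sub_smul, algebraMap_smul, sub_eq_zero] at this

variable (a M) in
/-- The map `(w_m)_m ↦ ∑_m h^m w_m` for finitely supported families of Whittaker vectors. -/
def whSum : ((Fin n → ℕ) →₀ Wh a M) →ₗ[ℂ] M :=
  Finsupp.lsum ℂ fun m => (Algebra.lsmul ℂ ℂ M (hMonomial m)).comp (Wh a M).subtype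

theorem whSum_apply (f : (Fin n → ℕ) →₀ Wh a M) :
    whSum a M f = f.sum fun m w => hMonomial m • (w : M) := by
  rw [whSum, Finsupp.lsum_apply]
  rfl

theorem whSum_single (m : Fin n → ℕ) (w : Wh a M) :
    whSum a M (Finsupp.single m w) = hMonomial m • (w : M) := by
  rw [whSum, Finsupp.lsum_single]
  rfl

theorem whSum_injective (ha : ∀ i, a i ≠ 0) : Function.Injective (whSum a M) := by
  rw [injective_iff_map_eq_zero]
  intro f hf
  rw [whSum_apply] at hf
  have := (isRaisingLowering a M ha).independent f.support (fun m => (f m : M))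
    (fun m i => mem_Wh_iff.mp (f m).2 i) (by
      simp only [opMonomial_euler]
      exact hf)
  ext m
  by_cases hm : m ∈ f.support
  · exact this m hm
  · rw [Finsupp.notMem_support_iff.mp hm]
    rfl

theorem whSum_surjective (ha : ∀ i, a i ≠ 0)
    (hnil : ∀ i (x : M), ∃ k, lowering a i ^ k • x = 0) : Function.Surjective (whSum a M) := by
  intro x
  have := (isRaisingLowering a M ha).mem_span (fun i x => by
    obtain ⟨k, hk⟩ := hnil i x
    exact ⟨k, by rw [← map_pow]; exact hk⟩) ⊤ (by simp) (by simp) (Submodule.mem_top (x := x))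
  rw [← LinearMap.mem_range]
  refine Submodule.span_le.mpr ?_ this
  rintro _ ⟨m, w, -, hw, rfl⟩
  exact ⟨Finsupp.single m ⟨w, mem_Wh_iff.mpr hw⟩, by rw [whSum_single, opMonomial_euler]; rfl⟩

/-! ### The filtration by order of annihilation -/

variable (a M) in
/-- The vectors killed by all products of `k` of the `∂_i - a_i`. -/
def whFiltration : ℕ → Submodule ℂ M
  | 0 => ⊥
  | k + 1 => ⨅ i, (whFiltration k).comap (Algebra.lsmul ℂ ℂ M (lowering a i))

theorem mem_whFiltration_succ {k : ℕ} {x : M} :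
    x ∈ whFiltration a M (k + 1) ↔ ∀ i, lowering a i • x ∈ whFiltration a M k := by
  rw [whFiltration, Submodule.mem_iInf]
  rfl

theorem whFiltration_mono : Monotone (whFiltration a M) := by
  refine monotone_nat_of_le_succ fun k => ?_
  induction k with
  | zero => exact bot_le
  | succ k ih =>
    exact fun x hx => mem_whFiltration_succ.mpr fun i =>
      ih (mem_whFiltration_succ.mp hx i)

theorem whFiltration_one : whFiltration a M 1 = Wh a M := by
  ext x
  rw [mem_whFiltration_succ, mem_Wh_iff]
  rfl

theorem lowering_smul_mem_whFiltration {k : ℕ} {x : M} (hx : x ∈ whFiltration a M (k + 1))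
    (y : Delta n) :
    (toUW (y : Witt n) - algebraMap ℂ (UW n) (phi a y)) • x ∈ whFiltration a M k :=
  toUW_sub_phi_smul_mem _ (mem_whFiltration_succ.mp hx) y

theorem pow_smul_eq_zero_of_mem_whFiltration {k : ℕ} {x : M} (hx : x ∈ whFiltration a M k)
    (y : Delta n) : (toUW (y : Witt n) - algebraMap ℂ (UW n) (phi a y)) ^ k • x = 0 := by
  induction k generalizing x with
  | zero =>
    rw [pow_zero, one_smul]
    exact hx
  | succ k ih =>
    rw [pow_succ, mul_smul]
    exact ih (lowering_smul_mem_whFiltration hx y)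

theorem toUW_smul_mem_whFiltration {k : ℕ} {x : M} (hx : x ∈ whFiltration a M k)
    (y : Delta n) : toUW (y : Witt n) • x ∈ whFiltration a M k := by
  have h := lowering_smul_mem_whFiltration (whFiltration_mono k.le_succ hx) y
  have h2 := add_mem h ((whFiltration a M k).smul_mem (phi a y) hx)
  rwa [sub_smul, algebraMap_smul, sub_add_cancel] at h2

/-- Moving `∂_i - a_i` past `y` gives two terms: either it reaches `x` and lowers `k`, or it
replaces `y` by `[∂_i, y]` and lowers `d`. Hence the double induction. -/
theorem smul_mem_whFiltration {d k : ℕ} {y : Witt n} (hy : DelNilpotent d y) {x : M}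
    (hx : x ∈ whFiltration a M k) : toUW y • x ∈ whFiltration a M (k + d) := by
  induction k generalizing d y x with
  | zero =>
    rw [show x = 0 from hx, smul_zero]
    exact zero_mem _
  | succ k ihk =>
    induction d generalizing y with
    | zero =>
      rw [show y = 0 from hy, map_zero, zero_smul]
      exact zero_mem _
    | succ d ihd =>
      refine mem_whFiltration_succ.mpr fun i => ?_
      rw [← mul_smul, lowering_mul_toUW, add_smul, mul_smul]
      refine add_mem ?_ ?_
      · have := ihk hy (mem_whFiltration_succ.mp hx i)
        rwa [← add_assoc, add_right_comm] at this
      · exact ihd (hy i)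

theorem exists_smul_mem_whFiltration (u : UW n) {x : M} (hx : ∃ k, x ∈ whFiltration a M k) :
    ∃ k, u • x ∈ whFiltration a M k := by
  induction u using UW_induction generalizing x with
  | hc c =>
    obtain ⟨k, hk⟩ := hx
    exact ⟨k, by rw [algebraMap_smul]; exact Submodule.smul_mem _ c hk⟩
  | hι y =>
    obtain ⟨k, hk⟩ := hx
    obtain ⟨d, hd⟩ := exists_delNilpotent y
    exact ⟨k + d, smul_mem_whFiltration hd hk⟩
  | hm u v hu hv =>
    rw [mul_smul]
    exact hu (hv hx)
  | ha u v hu hv =>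
    obtain ⟨k, hk⟩ := hu hx
    obtain ⟨l, hl⟩ := hv hx
    exact ⟨max k l, by
      rw [add_smul]
      exact add_mem (whFiltration_mono (le_max_left k l) hk)
        (whFiltration_mono (le_max_right k l) hl)⟩

theorem lowering_nilpotent (hM : ∀ x : M, ∃ k, x ∈ whFiltration a M k) (i : Fin n) (x : M) :
    ∃ k, lowering a i ^ k • x = 0 := by
  obtain ⟨k, hk⟩ := hM x
  refine ⟨k, ?_⟩
  have := pow_smul_eq_zero_of_mem_whFiltration hk ⟨del i, del_mem_Delta i⟩
  rwa [phi_del] at this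

theorem map_mem_whFiltration {N : Type*} [AddCommGroup N] [Module (UW n) N] [Module ℂ N]
    [IsScalarTower ℂ (UW n) N] (f : M →ₗ[UW n] N) {k : ℕ} {x : M} (hx : x ∈ whFiltration a M k) :
    f x ∈ whFiltration a N k := by
  induction k generalizing x with
  | zero => rw [show x = 0 from hx, map_zero]; exact zero_mem _
  | succ k ih =>
    refine mem_whFiltration_succ.mpr fun i => ?_
    rw [← map_smul]
    exact ih (mem_whFiltration_succ.mp hx i)

/-- The map `x ↦ (D_i x)_i` sends step `k + 1` into the `n`-th power of step `k`, and its kernel is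
`Wh_a(M)`. This yields local finiteness of the `Δ_n`-action on `Q_a ⊗ V`. -/
theorem finiteDimensional_whFiltration (h : FiniteDimensional ℂ (Wh a M)) (k : ℕ) :
    FiniteDimensional ℂ (whFiltration a M k) := by
  induction k with
  | zero => exact inferInstanceAs (FiniteDimensional ℂ (⊥ : Submodule ℂ M))
  | succ k ih =>
    rw [FiniteDimensional, Module.Finite.iff_fg]
    let Φ : M →ₗ[ℂ] (Fin n → M) := LinearMap.pi fun i => Algebra.lsmul ℂ ℂ M (lowering a i)
    refine Submodule.fg_of_fg_map_of_fg_inf_ker Φ ?_ ?_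
    · have hle : (whFiltration a M (k + 1)).map Φ ≤
          LinearMap.range ((whFiltration a M k).subtype.compLeft (Fin n)) := by
        rintro _ ⟨x, hx, rfl⟩
        exact ⟨fun i => ⟨lowering a i • x, mem_whFiltration_succ.mp hx i⟩, rfl⟩
      rw [← Module.Finite.iff_fg]
      exact Submodule.finiteDimensional_of_le hle
    · have hle : whFiltration a M (k + 1) ⊓ LinearMap.ker Φ ≤ Wh a M := fun x hx =>
        mem_Wh_iff.mpr fun i => congrFun (LinearMap.mem_ker.mp hx.2) i
      rw [← Module.Finite.iff_fg]
      exact Submodule.finiteDimensional_of_le hle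

end Structure

end WittWhittaker

end

noncomputable section

namespace WittWhittaker

attribute [local instance 100] LieRing.ofAssociativeRing

/-! ### The universal Whittaker module -/

section Universal

variable {n : ℕ} {a : Fin n → ℂ}

theorem Q.exists_mem_whFiltration (q : Q a) : ∃ k, q ∈ whFiltration a (Q a) k := by
  obtain ⟨u, rfl⟩ := Q.mk_surjective q
  rw [← mul_one u, ← Q.smul_mk]
  exact exists_smul_mem_whFiltration u ⟨1, by rw [whFiltration_one]; exact Q.mk_one_mem⟩

theorem hMonomial_zero : hMonomial (0 : Fin n → ℕ) = 1 := by
  rw [hMonomial, List.prod_eq_one]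
  intro x hx
  obtain ⟨i, rfl⟩ := (List.mem_ofFn' _ _).mp hx
  exact pow_zero _

/-- The element of `H_a` corresponding to a Whittaker vector of `Q_a`. -/
def ofWhQ (w : Wh a (Q a)) : H a := op (ofWh w)

theorem ofWhQ_smul (w : Wh a (Q a)) : op (ofWhQ w) • Q.mk a 1 = (w : Q a) := by
  rw [ofWhQ, op_op_smul_Q, ofWh_mk, one_smul]

theorem op_smul_mk (r : (H a)ᵐᵒᵖ) (u : UW n) : r • Q.mk a u = u • r • Q.mk a 1 := by
  rw [smul_comm, Q.smul_mk, mul_one]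

theorem op_smul_mem_Wh (r : (H a)ᵐᵒᵖ) : r • Q.mk a 1 ∈ Wh a (Q a) :=
  map_mem_Wh r.unop.unop Q.mk_one_mem

/-- The identification of `H_a` with the Whittaker vectors of `Q_a`. -/
def homToWh : (H a)ᵐᵒᵖ →+ Wh a (Q a) where
  toFun r := ⟨r • Q.mk a 1, op_smul_mem_Wh r⟩
  map_zero' := Subtype.ext (zero_smul _ _)
  map_add' r s := Subtype.ext (add_smul r s _)

theorem homToWh_injective : Function.Injective (homToWh (a := a)) := by
  intro r s h
  apply unop_injective
  apply unop_injective
  exact Q.hom_ext (congrArg Subtype.val h)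

/-- The right action of `H_a` commutes with `h^m`, so an `H_a`-relation among the `h^m ⊗ 1_a` is a
relation `∑ h^m w_m = 0` with `w_m` the Whittaker vectors corresponding to the coefficients. -/
theorem linearIndependent_mk (ha : ∀ i, a i ≠ 0) :
    LinearIndependent (H a)ᵐᵒᵖ fun m : Fin n → ℕ => Q.mk a (hMonomial m) := by
  rw [linearIndependent_iff]
  intro l hl
  have h : whSum a (Q a) (l.mapRange homToWh (map_zero _)) = 0 := by
    rw [whSum_apply, Finsupp.sum_mapRange_index (fun m => by simp), ← hl,
      Finsupp.linearCombination_apply]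
    exact Finsupp.sum_congr fun m _ => (op_smul_mk _ _).symm
  have h' := whSum_injective ha (h.trans (map_zero _).symm)
  ext m : 1
  refine homToWh_injective ?_
  rw [Finsupp.zero_apply, map_zero]
  simpa using DFunLike.congr_fun h' m

theorem span_mk (ha : ∀ i, a i ≠ 0) :
    ⊤ ≤ Submodule.span (H a)ᵐᵒᵖ (Set.range fun m : Fin n → ℕ => Q.mk a (hMonomial m)) := by
  rintro q -
  obtain ⟨f, rfl⟩ := whSum_surjective ha (lowering_nilpotent Q.exists_mem_whFiltration) q
  rw [whSum_apply]
  refine Submodule.sum_mem _ fun m _ => ?_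
  change hMonomial m • ((f m : Wh a (Q a)) : Q a) ∈ _
  rw [← ofWhQ_smul, ← op_smul_mk]
  exact Submodule.smul_mem _ _ (Submodule.subset_span ⟨m, rfl⟩)

/-- The basis `h^m ⊗ 1_a` of `Q_a` over `H_a`. -/
def hBasis (ha : ∀ i, a i ≠ 0) : Module.Basis (Fin n → ℕ) (H a)ᵐᵒᵖ (Q a) :=
  Module.Basis.mk (linearIndependent_mk ha) (span_mk ha)

theorem hBasis_apply (ha : ∀ i, a i ≠ 0) (m : Fin n → ℕ) :
    hBasis ha m = Q.mk a (hMonomial m) :=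
  Module.Basis.mk_apply _ _ _

end Universal

/-! ### The tensor product functor -/

section Tensor

open scoped ModuleCat

variable {n : ℕ} {a : Fin n → ℂ}

section

variable (V : Type v) [AddCommGroup V] [Module (H a) V]

/-- The map `q ⊗ v ↦ c(q) v`, where `c(q)` is the coordinate of `q` at `1 ⊗ 1_a`, before passing to
the quotient `Q_a ⊗_{H_a} V` of `Q_a ⊗_ℤ V`. -/
def preCoordOne (ha : ∀ i, a i ≠ 0) : Q a ⊗[ℤ] V →+ V :=
  TensorProduct.liftAddHom
    { toFun := fun q => DistribSMul.toAddMonoidHom V ((hBasis ha).coord 0 q).unop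
      map_zero' := by ext v; simp
      map_add' := fun q q' => by ext v; simp [add_smul] }
    (fun k q v => by
      change ((hBasis ha).coord 0 (k • q)).unop • v = ((hBasis ha).coord 0 q).unop • k • v
      rw [map_zsmul, show (k • (hBasis ha).coord 0 q).unop = k • ((hBasis ha).coord 0 q).unop from
        map_zsmul MulOpposite.opAddEquiv.symm k _, smul_assoc, smul_comm])

theorem preCoordOne_tmul (ha : ∀ i, a i ≠ 0) (q : Q a) (v : V) :
    preCoordOne V ha (q ⊗ₜ v) = ((hBasis ha).coord 0 q).unop • v := rfl

theorem preCoordOne_eq_zero (ha : ∀ i, a i ≠ 0) {z : Q a ⊗[ℤ] V}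
    (hz : z ∈ balancedRelations (UW n) (H a) (Q a) V) : preCoordOne V ha z = 0 := by
  -- The relations are spanned over `U(W_n)`, but the coordinate map is only additive in that
  -- direction; quantifying over `u` makes the span induction go through.
  suffices h : ∀ u : UW n, preCoordOne V ha (u • z) = 0 by simpa using h 1
  induction hz using Submodule.span_induction with
  | mem z hz =>
    obtain ⟨q, r, v, rfl⟩ := hz
    intro u
    rw [smul_sub, TensorProduct.smul_tmul', TensorProduct.smul_tmul', smul_comm u (op r) q,
      map_sub, preCoordOne_tmul, preCoordOne_tmul, map_smul, smul_eq_mul, unop_mul, unop_op,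
      mul_smul, sub_self]
  | zero => simp
  | add x y _ _ hx hy => intro u; rw [smul_add, map_add, hx, hy, add_zero]
  | smul s x _ hx => intro u; rw [smul_smul]; exact hx _

end

section Functor

variable (V : ModuleCat.{v} (H a))

/-- The homomorphism `q ↦ q ⊗ v`. -/
def tmulRight (v : V) : Q a →ₗ[UW n] (tensorFunctor a).obj V where
  toFun q := BalancedTensor.tmul (UW n) (H a) q v
  map_add' q q' := by
    change BalancedTensor.tmul (UW n) (H a) (q + q') v =
      BalancedTensor.tmul (UW n) (H a) q v + BalancedTensor.tmul (UW n) (H a) q' v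
    simp [BalancedTensor.tmul, TensorProduct.add_tmul]
  map_smul' u q := (BalancedTensor.smul_tmul' _ _ u q v).symm

theorem tmulRight_op_smul (r : H a) (q : Q a) (v : V) :
    tmulRight V v (op r • q) = tmulRight V (r • v) q :=
  BalancedTensor.op_smul_tmul _ _ _ _ _

theorem tensor_induction {p : (tensorFunctor a).obj V → Prop} (h0 : p 0)
    (ht : ∀ q v, p (tmulRight V v q)) (ha : ∀ x y, p x → p y → p (x + y))
    (x : (tensorFunctor a).obj V) : p x :=
  BalancedTensor.induction h0 ht ha x

/-- The map `v ↦ (1 ⊗ 1_a) ⊗ v` from `V` to the Whittaker vectors of `Q_a ⊗ V`. -/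
def toWhTensor : V →ₗ[H a] Wh a ((tensorFunctor a).obj V) where
  toFun v := ⟨tmulRight V v (Q.mk a 1), map_mem_Wh _ Q.mk_one_mem⟩
  map_add' v w := Subtype.ext (by
    change BalancedTensor.tmul (UW n) (H a) _ (v + w) =
      BalancedTensor.tmul (UW n) (H a) _ v + BalancedTensor.tmul (UW n) (H a) _ w
    rw [BalancedTensor.tmul, TensorProduct.tmul_add, map_add]
    rfl)
  map_smul' r v := Subtype.ext (by
    change tmulRight V (r • v) (Q.mk a 1) = ofWh _ (r.unop (Q.mk a 1))
    rw [← tmulRight_op_smul]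
    change tmulRight V v (r.unop (Q.mk a 1)) = _
    refine LinearMap.congr_fun (Q.hom_ext ?_) _
    rw [ofWh_mk, one_smul])

theorem coe_toWhTensor (v : V) :
    (toWhTensor V v : (tensorFunctor a).obj V) = tmulRight V v (Q.mk a 1) := rfl

/-- The coordinate of `1 ⊗ 1_a = h^0 ⊗ 1_a` at `m = 0` is `1`, so `preCoordOne` recovers `v`. -/
theorem toWhTensor_injective (ha : ∀ i, a i ≠ 0) : Function.Injective (toWhTensor V) := by
  rw [injective_iff_map_eq_zero]
  intro v hv
  have h : (balancedRelations (UW n) (H a) (Q a) V).mkQ (Q.mk a 1 ⊗ₜ[ℤ] v) = 0 :=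
    congrArg Subtype.val hv
  rw [Submodule.mkQ_apply, Submodule.Quotient.mk_eq_zero] at h
  have h2 := preCoordOne_eq_zero V ha h
  rw [preCoordOne_tmul, ← hMonomial_zero, ← hBasis_apply ha] at h2
  simpa using h2

theorem tensor_exists_mem_whFiltration (x : (tensorFunctor a).obj V) :
    ∃ k, x ∈ whFiltration a ((tensorFunctor a).obj V) k := by
  induction x using tensor_induction with
  | h0 => exact ⟨0, zero_mem _⟩
  | ht q v =>
    obtain ⟨k, hk⟩ := Q.exists_mem_whFiltration q
    exact ⟨k, map_mem_whFiltration _ hk⟩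
  | ha x y hx hy =>
    obtain ⟨k, hk⟩ := hx
    obtain ⟨l, hl⟩ := hy
    exact ⟨max k l, add_mem (whFiltration_mono (le_max_left k l) hk)
      (whFiltration_mono (le_max_right k l) hl)⟩

theorem map_whSum {M N : Type*} [AddCommGroup M] [Module (UW n) M] [Module ℂ M]
    [IsScalarTower ℂ (UW n) M] [AddCommGroup N] [Module (UW n) N] [Module ℂ N]
    [IsScalarTower ℂ (UW n) N] (g : M →ₗ[UW n] N) (f : (Fin n → ℕ) →₀ Wh a M) :
    g (whSum a M f) = whSum a N (f.mapRange (whMap g) (map_zero _)) := by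
  rw [whSum_apply, whSum_apply, Finsupp.sum_mapRange_index (fun m => by simp), Finsupp.sum,
    map_sum]
  exact Finset.sum_congr rfl fun m _ => map_smul g _ _

/-- A Whittaker vector of `Q_a` is the generator times an element of `H_a`, and that element crosses
the tensor sign. -/
theorem whMap_tmulRight (v : V) (w : Wh a (Q a)) :
    whMap (tmulRight V v) w = toWhTensor V (ofWhQ w • v) := by
  refine Subtype.ext ?_
  rw [coe_toWhTensor, ← tmulRight_op_smul, ofWhQ_smul]
  rfl

theorem exists_whSum_toWhTensor (ha : ∀ i, a i ≠ 0) (x : (tensorFunctor a).obj V) :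
    ∃ g : (Fin n → ℕ) →₀ V,
      whSum a ((tensorFunctor a).obj V) (g.mapRange (toWhTensor V) (map_zero _)) = x := by
  induction x using tensor_induction with
  | h0 => exact ⟨0, by rw [Finsupp.mapRange_zero, map_zero]⟩
  | ht q v =>
    obtain ⟨f, rfl⟩ := whSum_surjective ha (lowering_nilpotent Q.exists_mem_whFiltration) q
    have h0 : ofWhQ (0 : Wh a (Q a)) • v = 0 := by
      rw [ofWhQ, ofWh_zero, op_zero, zero_smul]
    refine ⟨f.mapRange (fun w => ofWhQ w • v) h0, ?_⟩
    rw [map_whSum]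
    congr 1
    ext m : 1
    exact (whMap_tmulRight V v (f m)).symm
  | ha x y hx hy =>
    obtain ⟨f, rfl⟩ := hx
    obtain ⟨g, rfl⟩ := hy
    refine ⟨f + g, ?_⟩
    rw [Finsupp.mapRange_add (map_add _), map_add]

theorem toWhTensor_surjective (ha : ∀ i, a i ≠ 0) : Function.Surjective (toWhTensor V) := by
  intro y
  obtain ⟨g, hg⟩ := exists_whSum_toWhTensor V ha (y : (tensorFunctor a).obj V)
  have h : whSum a ((tensorFunctor a).obj V) (Finsupp.single 0 y) = y := by
    rw [whSum_single, hMonomial_zero, one_smul]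
  refine ⟨g 0, ?_⟩
  -- The Whittaker vector `y` has two expansions, `h^0 y` and `∑ h^m (1 ⊗ g m)`; uniqueness
  -- identifies their terms at `m = 0`.
  have := DFunLike.congr_fun (whSum_injective ha (hg.trans h.symm)) 0
  rwa [Finsupp.mapRange_apply, Finsupp.single_eq_same] at this

/-- `V` is isomorphic to the module of Whittaker vectors of `Q_a ⊗ V`. -/
def whTensorEquiv (ha : ∀ i, a i ≠ 0) : V ≃ₗ[H a] Wh a ((tensorFunctor a).obj V) :=
  LinearEquiv.ofBijective (toWhTensor V) ⟨toWhTensor_injective V ha, toWhTensor_surjective V ha⟩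

variable (M : ModuleCat.{v} (UW n))

/-- The homomorphism `Q_a ⊗ Wh_a(M) → M` with `q ⊗ w ↦ q w`, where `q` acts through the
homomorphism `Q_a → M` attached to `w`. -/
def evalWh : (tensorFunctor a).obj ((whFunctor a).obj M) →ₗ[UW n] M :=
  (balancedRelations (UW n) (H a) (Q a) (Wh a M)).liftQ
    (TensorProduct.AlgebraTensorModule.lift
      { toFun := fun q =>
          { toFun := fun w : Wh a M => ofWh w q
            map_add' := fun v w => by rw [ofWh_add]; rfl
            map_smul' := fun k w => map_zsmul (AddMonoidHom.mk' (fun w : Wh a M => ofWh w q)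
              (fun v w => by rw [ofWh_add]; rfl)) k w }
        map_add' := fun q q' => LinearMap.ext fun w => map_add (ofWh w) q q'
        map_smul' := fun u q => LinearMap.ext fun w => map_smul (ofWh w) u q })
    (by
      unfold balancedRelations
      rw [Submodule.span_le]
      rintro _ ⟨q, r, w, rfl⟩
      rw [SetLike.mem_coe, LinearMap.mem_ker, map_sub, sub_eq_zero]
      change ofWh w (r.unop q) = ofWh (r • w) q
      rw [ofWh_H_smul]
      rfl)

theorem evalWh_tmulRight (w : Wh a M) (q : Q a) :
    evalWh M (tmulRight ((whFunctor a).obj M) w q) = ofWh w q := rfl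

/-- In terms of expansions in the `h^m`, evaluation becomes `whSum` for `M`, which reduces its
bijectivity to that of `whSum`. -/
theorem evalWh_whSum (g : (Fin n → ℕ) →₀ Wh a M) :
    evalWh M (whSum a _ (g.mapRange (toWhTensor ((whFunctor a).obj M)) (map_zero _))) =
      whSum a M g := by
  rw [map_whSum]
  congr 1
  ext m
  change evalWh M (tmulRight ((whFunctor a).obj M) (g m) (Q.mk a 1)) = _
  rw [evalWh_tmulRight, ofWh_mk, one_smul]

theorem evalWh_bijective (ha : ∀ i, a i ≠ 0)
    (hM : ∀ i (x : M), ∃ k, lowering a i ^ k • x = 0) : Function.Bijective (evalWh (a := a) M) := by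
  constructor
  · rw [injective_iff_map_eq_zero]
    intro x hx
    obtain ⟨g, rfl⟩ := exists_whSum_toWhTensor ((whFunctor a).obj M) ha x
    have h : g = (0 : (Fin n → ℕ) →₀ Wh a M) :=
      whSum_injective ha ((evalWh_whSum M g).symm.trans (hx.trans (map_zero _).symm))
    rw [h]
    exact (congrArg _ Finsupp.mapRange_zero).trans (map_zero _)
  · intro x
    obtain ⟨g, rfl⟩ := whSum_surjective ha hM x
    exact ⟨_, evalWh_whSum M g⟩

/-- `Q_a ⊗ Wh_a(M)` is isomorphic to `M`, for a module `M` of type `φ_a`. -/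
def evalWhEquiv (ha : ∀ i, a i ≠ 0) (hM : ∀ i (x : M), ∃ k, lowering a i ^ k • x = 0) :
    (tensorFunctor a).obj ((whFunctor a).obj M) ≃ₗ[UW n] M :=
  LinearEquiv.ofBijective (evalWh M) (evalWh_bijective M ha hM)

end Functor

end Tensor

/-! ### The equivalence of categories -/

section Equivalence

open scoped ModuleCat

variable {n : ℕ} {a : Fin n → ℂ}

/-- The complex structure restricted from `H_a` agrees with that of a subspace of `M`, so
finite-dimensionality means the same in both categories. -/
theorem algebraMap_smul_Wh {M : Type v} [AddCommGroup M] [Module (UW n) M] [Module ℂ M]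
    [IsScalarTower ℂ (UW n) M] (c : ℂ) (w : Wh a M) : algebraMap ℂ (H a) c • w = c • w := by
  refine Subtype.ext ?_
  rw [coe_H_smul]
  change ofWh w (c • Q.mk a 1) = c • (w : M)
  rw [LinearMap.map_smul_of_tower, ofWh_mk, one_smul]

theorem finDim_whFunctor (M : ModuleCat.{v} (UW n)) (hM : FiniteDimensional ℂ (Wh a M)) :
    finDim a ((whFunctor a).obj M) := by
  let e : Wh a M →ₗ[ℂ] (whFunctor a).obj M :=
    { toFun := fun w => w
      map_add' := fun _ _ => rfl
      map_smul' := fun c w => (algebraMap_smul_Wh c w).symm }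
  exact Module.Finite.of_surjective e fun w => ⟨w, rfl⟩

theorem lowering_nilpotent_of_isOfType {M : ModuleCat.{v} (UW n)} (hM : IsOfType a M) (i : Fin n)
    (x : M) : ∃ k, lowering a i ^ k • x = 0 := by
  obtain ⟨k, hk⟩ := hM x
  refine ⟨k, ?_⟩
  have := hk ⟨del i, del_mem_Delta i⟩
  rwa [phi_del] at this

theorem omega_tensorFunctor (ha : ∀ i, a i ≠ 0) (V : ModuleCat.{v} (H a)) (hV : finDim a V) :
    Omega a ((tensorFunctor a).obj V) := by
  have hfin : FiniteDimensional ℂ (Wh a ((tensorFunctor a).obj V)) := by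
    let e : V →ₗ[ℂ] Wh a ((tensorFunctor a).obj V) :=
      { toFun := toWhTensor V
        map_add' := map_add _
        map_smul' := fun c v => (map_smul (toWhTensor V) (algebraMap ℂ (H a) c) v).trans
          (algebraMap_smul_Wh c _) }
    have : FiniteDimensional ℂ V := hV
    exact Module.Finite.of_surjective e (toWhTensor_surjective V ha)
  refine ⟨fun w => ?_, fun w => ?_, hfin⟩
  · obtain ⟨k, hk⟩ := tensor_exists_mem_whFiltration V w
    exact ⟨_, finiteDimensional_whFiltration hfin k, hk,
      fun x y hy => toUW_smul_mem_whFiltration hy x⟩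
  · obtain ⟨k, hk⟩ := tensor_exists_mem_whFiltration V w
    exact ⟨k, pow_smul_eq_zero_of_mem_whFiltration hk⟩

theorem ofWh_whMap {M N : Type*} [AddCommGroup M] [Module (UW n) M] [Module ℂ M]
    [IsScalarTower ℂ (UW n) M] [AddCommGroup N] [Module (UW n) N] [Module ℂ N]
    [IsScalarTower ℂ (UW n) N] (f : M →ₗ[UW n] N) (w : Wh a M) :
    ofWh (whMap f w) = f.comp (ofWh w) := by
  apply Q.hom_ext
  rw [LinearMap.comp_apply, ofWh_mk, ofWh_mk, one_smul, one_smul]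
  rfl

theorem evalWh_naturality {M N : ModuleCat.{v} (UW n)} (f : M ⟶ N)
    (x : (tensorFunctor a).obj ((whFunctor a).obj M)) :
    evalWh N (((tensorFunctor a).map ((whFunctor a).map f)).hom x) = f.hom (evalWh M x) := by
  induction x using tensor_induction with
  | h0 => simp
  | ht q w => exact LinearMap.congr_fun (ofWh_whMap f.hom w) q
  | ha x y hx hy => rw [map_add, map_add, map_add, map_add, hx, hy]

end Equivalence

end WittWhittaker

end

theorem theorem4p8 {n : ℕ} (a : Fin n → ℂ) (ha : ∀ i, a i ≠ 0) :
    (∃ b : Module.Basis (Fin n → ℕ) (WittWhittaker.H a)ᵐᵒᵖ (WittWhittaker.Q a),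
      ∀ m, b m = WittWhittaker.Q.mk a (WittWhittaker.hMonomial m)) ∧
    ∃ (hWh : ∀ M : (WittWhittaker.Omega.{v} a).FullSubcategory,
        WittWhittaker.finDim a ((WittWhittaker.whFunctor a).obj M.obj))
      (hQ : ∀ V : (WittWhittaker.finDim.{v} a).FullSubcategory,
        WittWhittaker.Omega a ((WittWhittaker.tensorFunctor a).obj V.obj))
      (E : (WittWhittaker.Omega.{v} a).FullSubcategory ≌
        (WittWhittaker.finDim.{v} a).FullSubcategory),
      E.functor = (WittWhittaker.finDim a).lift
        ((WittWhittaker.Omega a).ι ⋙ WittWhittaker.whFunctor a) hWh ∧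
      E.inverse = (WittWhittaker.Omega a).lift
        ((WittWhittaker.finDim a).ι ⋙ WittWhittaker.tensorFunctor a) hQ := by
  refine ⟨⟨WittWhittaker.hBasis ha, WittWhittaker.hBasis_apply ha⟩,
    fun M => WittWhittaker.finDim_whFunctor M.obj M.property.2.2,
    fun V => WittWhittaker.omega_tensorFunctor ha V.obj V.property, ?_⟩
  let counit := NatIso.ofComponents
    (F := (WittWhittaker.finDim a).lift ((WittWhittaker.Omega a).ι ⋙ WittWhittaker.whFunctor a)
        (fun M => WittWhittaker.finDim_whFunctor M.obj M.property.2.2) ⋙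
      (WittWhittaker.Omega a).lift ((WittWhittaker.finDim a).ι ⋙ WittWhittaker.tensorFunctor a)
        (fun V => WittWhittaker.omega_tensorFunctor ha V.obj V.property))
    (G := 𝟭 (WittWhittaker.Omega.{v} a).FullSubcategory)
    (fun M => ObjectProperty.isoMk _ (WittWhittaker.evalWhEquiv M.obj ha
      (WittWhittaker.lowering_nilpotent_of_isOfType M.property.2.1)).toModuleIso)
    (fun f => ObjectProperty.hom_ext _ (ModuleCat.hom_ext (LinearMap.ext fun x =>
      WittWhittaker.evalWh_naturality f.hom x)))
  let unit := NatIso.ofComponents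
    (F := 𝟭 (WittWhittaker.finDim.{v} a).FullSubcategory)
    (G := (WittWhittaker.Omega a).lift
        ((WittWhittaker.finDim a).ι ⋙ WittWhittaker.tensorFunctor a)
        (fun V => WittWhittaker.omega_tensorFunctor ha V.obj V.property) ⋙
      (WittWhittaker.finDim a).lift ((WittWhittaker.Omega a).ι ⋙ WittWhittaker.whFunctor a)
        (fun M => WittWhittaker.finDim_whFunctor M.obj M.property.2.2))
    (fun V => ObjectProperty.isoMk _ (WittWhittaker.whTensorEquiv V.obj ha).toModuleIso)
    (fun f => ObjectProperty.hom_ext _ (ModuleCat.hom_ext (LinearMap.ext fun v => rfl)))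
  -- `unit` and `counit` are named with the tensor functor on the left. Here `Wh_a` is the forward
  -- functor, so their inverses exchange roles.
  exact ⟨CategoryTheory.Equivalence.mk _ _ counit.symm unit.symm, rfl, rfl⟩
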